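/- Let $X$ be a (real) Banach space and let $G$ be an additive abelian group with a norm $|\cdot|$ (so $|g|\ge 0$ with equality only for $g=0$, $|-g|=|g|$, $|g+h|\le|g|+|h|$) that is complete in the metric $|g-h|$. A polyhedral $0$-chain is a finite formal sum $P=\sum_i g_i[x_i]$ with $g_i\in G$ and distinct $x_i\in X$; its mass is $M(P)=\sum_i|g_i|$. A polyhedral $1$-chain is a finite formal sum $\sum_i g_i[x_i,y_i]$ of oriented segments with coefficients in $G$, modulo $(g+h)[x,y]=g[x,y]+h[x,y]$, $g[y,x]=(-g)[x,y]$, $g[x,x]=0$ and $g[x,z]=g[x,y]+g[y,z]$ for $y$ in the open segment from $x$ to $z$; its boundary is given by $\partial(g[x,y])=g[y]-g[x]$. For $f\in X^*$ and almost every $r\in\mathbf R$ let $P_r$ be the portion of a polyhedral chain $P$ in $f^{-1}((-\infty,r))$. The mass of a simple $1$-chain $P=g[x,y]$ is $$M(P)=\sup_{f\in X^*,\ \|f\|=1}\int_{-\infty}^{\infty}M\big(\partial(P_r)-(\partial P)_r\big)\,dr ,$$ and the mass of an arbitrary polyhedral $1$-chain is the sum of the masses of the summands in a representation of it by simple chains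 on non-degenerate, pairwise disjoint open segments. The flat norm of a polyhedral $0$-chain $P$ is $$F(P)=\inf_Q\big(M(Q)+M(\partial Q-P)\big),$$ the infimum being over all polyhedral $1$-chains $Q$. Flat $0$-chains are the elements of the completion $\mathcal C_0(X,G)$ of the group of polyhedral $0$-chains in the norm $F$. The mass $M(A)\in[0,\infty]$ of $A\in\mathcal C_0(X,G)$ is the smallest $m$ for which there are polyhedral $0$-chains $P_i\to A$ with $M(P_i)\to m$. For a $0$-chain $P$ let $P\llcorner B(x,r)$ be its portion in the open ball $B(x,r)$. Let $A\in\mathcal C_0(X,G)$ and let $(P_i)$ be polyhedral $0$-chains converging rapidly to $A$, that is, $\sum_iF(P_i-A)<\infty$. A radius $r$ is non-exceptional (for $x$ and $(P_i)$) if $\sum_iF\big((P_{i+1}-P_i)\llcorner B(x,r)\big)<\infty$; then $A\llcorner B(x,r)=\lim_iP_i\llcorner B(x,r)$ exists in $\mathcal C_0(X,G)$. The support $\operatorname{spt}(A)$ is the set of those $x\in X$ for which, whichever rapidly converging sequence $(P_i)$ is used, there are non-exceptional radii $r_j\downarrow0$ with $F(A\llcorner B(x,r_j))>0$ for all $j$.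 Proposition. Let $(A_j)$ be a sequence in $\mathcal C_0(X,G)$ such that 1. the set $G_d=\{g\in G:|g|\le d\}$ is compact for all $d\in\mathbf R$; 2. there is a compact set $K\subset X$ with $\operatorname{spt}(A_j)\subset K$ for all $j$; 3. there is a constant $q$ with $M(A_j)\le q$ for all $j$. Then $(A_j)$ has a subsequence that converges in $\mathcal C_0(X,G)$ with respect to the flat norm. -/

import Mathlib

open Filter Topology MeasureTheory
open scoped ENNReal NNReal

noncomputable section

namespace FlatChain

/-! ### Polyhedral `0`-chains -/

/-- Polyhedral `0`-chains in `X` with coefficients in `G`: finite formal sums `∑ gᵢ [xᵢ]`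
of points. (A type synonym, so that it can carry the flat norm.) -/
def ZeroChain (X G : Type*) [NormedAddCommGroup G] : Type _ := X →₀ G

section Zero

variable {X G : Type*} [NormedAddCommGroup G]

instance : AddCommGroup (ZeroChain X G) := inferInstanceAs (AddCommGroup (X →₀ G))

/-- The `0`-chain `g [x]`. -/
def pt (x : X) : G →+ ZeroChain X G := Finsupp.singleAddHom x

/-- The mass `∑ |gᵢ|` of the `0`-chain `∑ gᵢ [xᵢ]` with distinct `xᵢ`. -/
def mass0 (P : ZeroChain X G) : ℝ≥0∞ := Finsupp.sum P fun _ g => ‖g‖ₑ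

/-- The portion of the `0`-chain `P` in `f⁻¹((-∞, r))`. -/
def restrict0 (f : X → ℝ) (r : ℝ) : ZeroChain X G →+ ZeroChain X G :=
  Finsupp.filterAddHom fun x => f x < r

theorem mass0_zero : mass0 (0 : ZeroChain X G) = 0 := Finsupp.sum_zero_index

theorem mass0_pt (x : X) (g : G) : mass0 (pt x g) = ‖g‖ₑ :=
  Finsupp.sum_single_index (by simp)

theorem mass0_neg (P : ZeroChain X G) : mass0 (-P) = mass0 P := by
  have h := Finsupp.sum_neg_index (g := (P : X →₀ G)) (h := fun _ g => ‖g‖ₑ) (by simp)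
  refine h.trans ?_
  simp [mass0]

theorem mass0_add_le (P Q : ZeroChain X G) : mass0 (P + Q) ≤ mass0 P + mass0 Q := by
  classical
  let p : X →₀ G := P
  let q : X →₀ G := Q
  have e1 : mass0 P = ∑ x ∈ p.support ∪ q.support, ‖p x‖ₑ :=
    Finsupp.sum_of_support_subset p Finset.subset_union_left _ (by simp)
  have e2 : mass0 Q = ∑ x ∈ p.support ∪ q.support, ‖q x‖ₑ :=
    Finsupp.sum_of_support_subset q Finset.subset_union_right _ (by simp)
  have e3 : mass0 (P + Q) = ∑ x ∈ p.support ∪ q.support, ‖(p + q) x‖ₑ :=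
    Finsupp.sum_of_support_subset (p + q) Finsupp.support_add _ (by simp)
  rw [e1, e2, e3, ← Finset.sum_add_distrib]
  exact Finset.sum_le_sum fun x _ => enorm_add_le _ _

theorem mass0_ne_top (P : ZeroChain X G) : mass0 P ≠ ∞ :=
  (ENNReal.sum_lt_top.2 fun _ _ => enorm_lt_top).ne

end Zero

/-! ### Polyhedral `1`-chains -/

section One

set_option linter.unusedSectionVars false

variable {X G : Type*} [NormedAddCommGroup X] [NormedSpace ℝ X] [NormedAddCommGroup G]

variable (X G) in
/-- The relations between formal sums of oriented segments; the pair `(x, y)` is the segment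
from `x` to `y`. A degenerate segment is zero, reversing the orientation changes the sign, and
a segment is the sum of the two pieces into which an interior point divides it. -/
def relations : AddSubgroup (X × X →₀ G) :=
  AddSubgroup.closure
    ({c | ∃ x g, c = Finsupp.single (x, x) g} ∪
     {c | ∃ x y g, c = Finsupp.single (x, y) g + Finsupp.single (y, x) g} ∪
     {c | ∃ x y z g, y ∈ openSegment ℝ x z ∧
        c = Finsupp.single (x, z) g - Finsupp.single (x, y) g - Finsupp.single (y, z) g})

variable (X G) in
/-- Polyhedral `1`-chains in `X` with coefficients in `G`. -/
def OneChain : Type _ := (X × X →₀ G) ⧸ relations X G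

instance : AddCommGroup (OneChain X G) :=
  inferInstanceAs (AddCommGroup ((X × X →₀ G) ⧸ relations X G))

/-- The simple `1`-chain `g [x, y]`. -/
def seg (x y : X) : G →+ OneChain X G :=
  (QuotientAddGroup.mk' (relations X G)).comp (Finsupp.singleAddHom (x, y))

/-- The boundary on formal sums of segments. -/
def boundaryFree : (X × X →₀ G) →+ ZeroChain X G :=
  Finsupp.liftAddHom fun p => pt p.2 - pt p.1

theorem boundaryFree_single (x y : X) (g : G) :
    boundaryFree (Finsupp.single (x, y) g) = pt y g - pt x g := by
  simp [boundaryFree]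

/-- The boundary operator, `∂ (g [x, y]) = g [y] - g [x]`. -/
def boundary : OneChain X G →+ ZeroChain X G :=
  QuotientAddGroup.lift (relations X G) boundaryFree (by
    rw [relations, AddSubgroup.closure_le]
    rintro c ((⟨x, g, rfl⟩ | ⟨x, y, g, rfl⟩) | ⟨x, y, z, g, -, rfl⟩) <;>
      simp only [SetLike.mem_coe, AddMonoidHom.mem_ker, map_add, map_sub, boundaryFree_single] <;>
      abel)

/-- The portion of `g [x, y]` in `f⁻¹((-∞, r))`, for a linear functional `f`. -/
def portion (f : X →L[ℝ] ℝ) (r : ℝ) (g : G) (x y : X) : OneChain X G :=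
  let p := AffineMap.lineMap x y ((r - f x) / (f y - f x))
  if f x < r then
    if f y < r then seg x y g else seg x p g
  else
    if f y < r then seg p y g else 0

/-- The slice `∂(P_r) - (∂P)_r` of `P = g [x, y]` by `f` at `r`. -/
def slice (f : X →L[ℝ] ℝ) (r : ℝ) (g : G) (x y : X) : ZeroChain X G :=
  boundary (portion f r g x y) - restrict0 f r (boundary (seg x y g))

/-- The mass of the simple `1`-chain `g [x, y]`. -/
def simpleMass (g : G) (x y : X) : ℝ≥0∞ :=
  ⨆ (f : X →L[ℝ] ℝ) (_ : ‖f‖ = 1), ∫⁻ r : ℝ, mass0 (slice f r g x y)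

/-- The segments from `x i` to `y i` are non-degenerate and pairwise disjoint
(as open segments). -/
def NonOverlapping {ι : Type*} (x y : ι → X) : Prop :=
  (∀ i, x i ≠ y i) ∧
    Pairwise fun i j => Disjoint (openSegment ℝ (x i) (y i)) (openSegment ℝ (x j) (y j))

/-- The mass of a polyhedral `1`-chain: the sum of the masses of the summands in a representation
by simple chains on pairwise disjoint open segments. (The sum does not depend on the
representation.) -/
def mass1 (Q : OneChain X G) : ℝ≥0∞ :=
  sInf {m | ∃ (n : ℕ) (g : Fin n → G) (x y : Fin n → X), NonOverlapping x y ∧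
    ∑ i, seg (x i) (y i) (g i) = Q ∧ m = ∑ i, simpleMass (g i) (x i) (y i)}

/-! Basic facts on mass, needed for the triangle inequality of the flat norm. -/

theorem boundary_seg (x y : X) (g : G) : boundary (seg x y g) = pt y g - pt x g :=
  boundaryFree_single x y g

theorem seg_self (x : X) (g : G) : seg x x g = 0 :=
  (QuotientAddGroup.eq_zero_iff _).2
    (AddSubgroup.subset_closure (Or.inl (Or.inl ⟨x, g, rfl⟩)))

theorem seg_swap (x y : X) (g : G) : seg y x g = seg x y (-g) := by
  have h : seg x y g + seg y x g = 0 :=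
    (QuotientAddGroup.eq_zero_iff _).2
      (AddSubgroup.subset_closure (Or.inl (Or.inr ⟨x, y, g, rfl⟩)))
  rw [map_neg]
  exact (neg_eq_of_add_eq_zero_right h).symm

theorem seg_split {x y z : X} (h : y ∈ openSegment ℝ x z) (g : G) :
    seg x z g = seg x y g + seg y z g := by
  have h : seg x z g - seg x y g - seg y z g = 0 :=
    (QuotientAddGroup.eq_zero_iff _).2
      (AddSubgroup.subset_closure (Or.inr ⟨x, y, z, g, h, rfl⟩))
  rw [← sub_eq_zero, ← h]; abel

theorem restrict0_pt (f : X → ℝ) (r : ℝ) (x : X) (g : G) :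
    restrict0 f r (pt x g) = if f x < r then pt x g else 0 := by
  split_ifs with h
  · exact Finsupp.filter_single_of_pos _ h
  · exact Finsupp.filter_single_of_neg _ h

theorem mass0_slice (f : X →L[ℝ] ℝ) (r : ℝ) (g : G) (x y : X) :
    mass0 (slice f r g x y) = (Set.uIoc (f x) (f y)).indicator (fun _ => ‖g‖ₑ) r := by
  by_cases hx : f x < r <;> by_cases hy : f y < r
  · rw [Set.indicator_of_notMem (by simp [Set.mem_uIoc, hx, hy])]
    simp [slice, portion, boundary_seg, restrict0_pt, hx, hy, mass0_zero]
  · rw [Set.indicator_of_mem (by simp [Set.mem_uIoc, hx, not_lt.1 hy])]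
    simp [slice, portion, boundary_seg, restrict0_pt, hx, hy, mass0_pt]
  · rw [Set.indicator_of_mem (by simp [Set.mem_uIoc, hy, not_lt.1 hx])]
    simp [slice, portion, boundary_seg, restrict0_pt, hx, hy, mass0_pt, mass0_neg]
  · rw [Set.indicator_of_notMem (by simp [Set.mem_uIoc, hx, hy])]
    simp [slice, portion, boundary_seg, restrict0_pt, hx, hy, mass0_zero]

theorem simpleMass_eq (g : G) (x y : X) : simpleMass g x y = ‖g‖ₑ * edist x y := by
  have key : ∀ f : X →L[ℝ] ℝ, ∫⁻ r : ℝ, mass0 (slice f r g x y)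
      = ‖g‖ₑ * ENNReal.ofReal |f y - f x| := by
    intro f
    simp_rw [mass0_slice]
    rw [lintegral_indicator_const measurableSet_uIoc, Real.volume_uIoc]
  have hd : edist x y = ENNReal.ofReal ‖y - x‖ := by
    rw [edist_dist, dist_comm, dist_eq_norm]
  simp only [simpleMass, key, hd]
  apply le_antisymm
  · refine iSup₂_le fun f hf => ?_
    gcongr
    rw [← map_sub, ← Real.norm_eq_abs]
    simpa [hf] using f.le_opNorm (y - x)
  · by_cases h : y - x = 0
    · simp [h]
    · obtain ⟨f, hf, hfv⟩ := exists_dual_vector ℝ (y - x) (norm_ne_zero_iff.2 h)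
      refine le_iSup₂_of_le f hf ?_
      rw [← map_sub, hfv]
      simp

/-- The chain with coefficient `c e` on each segment `e`, with a chosen orientation. -/
def chainOf (c : Sym2 X →₀ G) : OneChain X G :=
  c.sum fun e h => seg (Quot.out e).1 (Quot.out e).2 h

/-- The sum of coefficient norm times length. -/
def weight (c : Sym2 X →₀ G) : ℝ≥0∞ :=
  c.sum fun e h => ‖h‖ₑ * edist (Quot.out e).1 (Quot.out e).2

theorem chainOf_add (c d : Sym2 X →₀ G) : chainOf (c + d) = chainOf c + chainOf d := by
  classical
  exact Finsupp.sum_add_index' (by simp) (by simp)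

theorem weight_add_le (c d : Sym2 X →₀ G) : weight (c + d) ≤ weight c + weight d := by
  classical
  unfold weight
  rw [Finsupp.sum_of_support_subset c (Finset.subset_union_left (s₂ := d.support)) _ (by simp),
    Finsupp.sum_of_support_subset d (Finset.subset_union_right (s₁ := c.support)) _ (by simp),
    Finsupp.sum_of_support_subset (c + d) Finsupp.support_add _ (by simp),
    ← Finset.sum_add_distrib]
  refine Finset.sum_le_sum fun e _ => ?_
  rw [← add_mul]
  gcongr
  exact enorm_add_le _ _

theorem out_cases (a b : X) : Quot.out s(a, b) = (a, b) ∨ Quot.out s(a, b) = (b, a) := by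
  have h : s((Quot.out s(a, b)).1, (Quot.out s(a, b)).2) = s(a, b) := Quot.out_eq s(a, b)
  rw [Sym2.eq_iff] at h
  rcases h with ⟨h1, h2⟩ | ⟨h1, h2⟩
  · exact Or.inl (Prod.ext h1 h2)
  · exact Or.inr (Prod.ext h1 h2)

theorem openSegment_mono {x y p q : X} (hp : p ∈ segment ℝ x y) (hq : q ∈ segment ℝ x y)
    (hpq : p ≠ q) : openSegment ℝ p q ⊆ openSegment ℝ x y := by
  rw [segment_eq_image_lineMap] at hp hq
  obtain ⟨s, hs, rfl⟩ := hp
  obtain ⟨t, ht, rfl⟩ := hq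
  have hst : s ≠ t := fun h => hpq (by rw [h])
  rw [openSegment_eq_image_lineMap ℝ x y, ← image_openSegment, openSegment_eq_Ioo' hst]
  refine Set.image_mono (Set.Ioo_subset_Ioo ?_ ?_)
  · exact le_min hs.1 ht.1
  · exact max_le hs.2 ht.2

/-- A segment with end points in the finite set `V` is subdivided by the points of `V` on it. -/
theorem subdivide (V : Finset X) (g : G) : ∀ (n : ℕ) (x y : X), x ∈ V → y ∈ V →
    ((V : Set X) ∩ openSegment ℝ x y).ncard ≤ n → ∃ c : Sym2 X →₀ G,
      chainOf c = seg x y g ∧ weight c ≤ ‖g‖ₑ * edist x y ∧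
      ∀ e ∈ c.support, ∃ a b, e = s(a, b) ∧ a ≠ b ∧ a ∈ V ∧ b ∈ V ∧
        (∀ v ∈ V, v ∉ openSegment ℝ a b) ∧ a ∈ segment ℝ x y ∧ b ∈ segment ℝ x y := by
  classical
  intro n
  induction n with
  | zero =>
    intro x y hx hy hn
    by_cases hxy : x = y
    · subst hxy
      exact ⟨0, by simp [chainOf, seg_self], by simp [weight], by simp⟩
    have hfin : ((V : Set X) ∩ openSegment ℝ x y).Finite := V.finite_toSet.inter_of_left _
    have hemp : ∀ v ∈ V, v ∉ openSegment ℝ x y := by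
      intro v hv hv'
      have h0 := (Set.ncard_eq_zero hfin).1 (Nat.le_zero.1 hn)
      exact Set.notMem_empty v (h0 ▸ ⟨hv, hv'⟩)
    have hsupp : ∀ h : G, ∀ e ∈ (Finsupp.single s(x, y) h).support, ∃ a b, e = s(a, b) ∧ a ≠ b ∧
        a ∈ V ∧ b ∈ V ∧ (∀ v ∈ V, v ∉ openSegment ℝ a b) ∧
        a ∈ segment ℝ x y ∧ b ∈ segment ℝ x y := by
      intro h e he
      have := Finsupp.support_single_subset he
      exact ⟨x, y, Finset.mem_singleton.1 this, hxy, hx, hy, hemp,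
        left_mem_segment ℝ x y, right_mem_segment ℝ x y⟩
    rcases out_cases x y with ho | ho
    · refine ⟨Finsupp.single s(x, y) g, ?_, ?_, hsupp g⟩
      · rw [chainOf, Finsupp.sum_single_index (by simp), ho]
      · rw [weight, Finsupp.sum_single_index (by simp), ho]
    · refine ⟨Finsupp.single s(x, y) (-g), ?_, ?_, hsupp (-g)⟩
      · rw [chainOf, Finsupp.sum_single_index (by simp), ho, seg_swap, neg_neg]
      · rw [weight, Finsupp.sum_single_index (by simp), ho, enorm_neg, edist_comm]
  | succ n ih =>
    intro x y hx hy hn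
    by_cases hle : ((V : Set X) ∩ openSegment ℝ x y).ncard ≤ n
    · exact ih x y hx hy hle
    have hfin : ((V : Set X) ∩ openSegment ℝ x y).Finite := V.finite_toSet.inter_of_left _
    obtain ⟨p, hpV, hp⟩ : ((V : Set X) ∩ openSegment ℝ x y).Nonempty := by
      rw [Set.nonempty_iff_ne_empty]
      intro h
      rw [h] at hle
      simp at hle
    by_cases hxy : x = y
    · subst hxy
      exact ⟨0, by simp [chainOf, seg_self], by simp [weight], by simp⟩
    have hps : p ∈ segment ℝ x y := openSegment_subset_segment ℝ x y hp
    obtain ⟨t, ht, rfl⟩ := (openSegment_eq_image_lineMap ℝ x y) ▸ hp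
    set p := AffineMap.lineMap x y t with hpdef
    have hinj : Function.Injective (AffineMap.lineMap x y : ℝ → X) :=
      AffineMap.lineMap_injective ℝ hxy
    have hx0 : (AffineMap.lineMap x y (0 : ℝ) : X) = x := AffineMap.lineMap_apply_zero x y
    have hy1 : (AffineMap.lineMap x y (1 : ℝ) : X) = y := AffineMap.lineMap_apply_one x y
    have hxp : x ≠ p := fun h => ht.1.ne (hinj (hx0.trans h))
    have hpy : p ≠ y := fun h => ht.2.ne (hinj (h.trans hy1.symm))
    have n1 : p ∉ openSegment ℝ x p := fun h => hxp (right_mem_openSegment_iff.1 h)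
    have n2 : p ∉ openSegment ℝ p y := fun h => hpy (left_mem_openSegment_iff.1 h)
    have card : ∀ S ⊆ openSegment ℝ x y, p ∉ S → ((V : Set X) ∩ S).ncard ≤ n := by
      intro S hS hpS
      have : ((V : Set X) ∩ S).ncard < ((V : Set X) ∩ openSegment ℝ x y).ncard :=
        Set.ncard_lt_ncard ⟨Set.inter_subset_inter_right _ hS,
          fun h => hpS (h ⟨hpV, hp⟩).2⟩ hfin
      omega
    obtain ⟨c, c1, c2, c3⟩ := ih x p hx hpV
      (card _ (openSegment_mono (left_mem_segment ℝ x y) hps hxp) n1)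
    obtain ⟨d, d1, d2, d3⟩ := ih p y hpV hy
      (card _ (openSegment_mono hps (right_mem_segment ℝ x y) hpy) n2)
    refine ⟨c + d, ?_, ?_, ?_⟩
    · rw [chainOf_add, c1, d1, seg_split hp]
    · refine (weight_add_le c d).trans ((add_le_add c2 d2).trans ?_)
      rw [← mul_add]
      gcongr
      rw [edist_dist, edist_dist, edist_dist, ← ENNReal.ofReal_add dist_nonneg dist_nonneg,
        dist_add_dist_of_mem_segment hps]
    · intro e he
      rcases Finset.mem_union.1 (Finsupp.support_add he) with h | h
      · obtain ⟨a, b, h1, h2, h3, h4, h5, h6, h7⟩ := c3 e h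
        have hs := (convex_segment x y).segment_subset (left_mem_segment ℝ x y) hps
        exact ⟨a, b, h1, h2, h3, h4, h5, hs h6, hs h7⟩
      · obtain ⟨a, b, h1, h2, h3, h4, h5, h6, h7⟩ := d3 e h
        have hs := (convex_segment x y).segment_subset hps (right_mem_segment ℝ x y)
        exact ⟨a, b, h1, h2, h3, h4, h5, hs h6, hs h7⟩

theorem exists_lineMap {x y p q a : X} (hp : p ∈ segment ℝ x y) (hq : q ∈ segment ℝ x y)
    (ha : a ∈ segment ℝ x y) (hpq : p ≠ q) : ∃ t : ℝ, AffineMap.lineMap p q t = a := by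
  rw [segment_eq_image_lineMap] at hp hq ha
  obtain ⟨s, -, rfl⟩ := hp
  obtain ⟨t, -, rfl⟩ := hq
  obtain ⟨u, -, rfl⟩ := ha
  have hst : t - s ≠ 0 := fun h => hpq (by rw [sub_eq_zero.1 h])
  refine ⟨(u - s) / (t - s), ?_⟩
  rw [← AffineMap.apply_lineMap]
  congr 1
  rw [AffineMap.lineMap_apply_ring', div_mul_cancel₀ _ hst, sub_add_cancel]

theorem real_openSegment_eq {a b c d u : ℝ} (hab : a ≠ b) (hcd : c ≠ d)
    (h1 : u ∈ openSegment ℝ a b) (h2 : u ∈ openSegment ℝ c d)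
    (hc : c ∉ openSegment ℝ a b) (hd : d ∉ openSegment ℝ a b)
    (ha : a ∉ openSegment ℝ c d) (hb : b ∉ openSegment ℝ c d) :
    (a = c ∧ b = d) ∨ (a = d ∧ b = c) := by
  simp only [openSegment_eq_Ioo' hab, openSegment_eq_Ioo' hcd] at *
  grind

theorem disjoint_pieces {x y x' y' a b a' b' : X} {V : Finset X}
    (hV : ∀ p, segment ℝ x y ∩ segment ℝ x' y' = {p} → p ∈ V)
    (hab : a ≠ b) (ha : a ∈ segment ℝ x y) (hb : b ∈ segment ℝ x y)
    (haV : a ∈ V) (hbV : b ∈ V) (hV1 : ∀ v ∈ V, v ∉ openSegment ℝ a b)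
    (hab' : a' ≠ b') (ha' : a' ∈ segment ℝ x' y') (hb' : b' ∈ segment ℝ x' y')
    (haV' : a' ∈ V) (hbV' : b' ∈ V) (hV2 : ∀ v ∈ V, v ∉ openSegment ℝ a' b')
    (hne : s(a, b) ≠ s(a', b')) :
    Disjoint (openSegment ℝ a b) (openSegment ℝ a' b') := by
  rw [Set.disjoint_left]
  intro p hp hp'
  have hpx : p ∈ segment ℝ x y :=
    (convex_segment x y).segment_subset ha hb (openSegment_subset_segment ℝ a b hp)
  have hpx' : p ∈ segment ℝ x' y' :=
    (convex_segment x' y').segment_subset ha' hb' (openSegment_subset_segment ℝ a' b' hp')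
  by_cases hq : ∃ q ∈ segment ℝ x y ∩ segment ℝ x' y', p ≠ q
  · obtain ⟨q, ⟨hq, hq'⟩, hpq⟩ := hq
    obtain ⟨s, rfl⟩ := exists_lineMap hpx hq ha hpq
    obtain ⟨t, rfl⟩ := exists_lineMap hpx hq hb hpq
    obtain ⟨s', rfl⟩ := exists_lineMap hpx' hq' ha' hpq
    obtain ⟨t', rfl⟩ := exists_lineMap hpx' hq' hb' hpq
    have hinj : Function.Injective (AffineMap.lineMap p q : ℝ → X) :=
      AffineMap.lineMap_injective ℝ hpq
    have hmem : ∀ u v w : ℝ, (AffineMap.lineMap p q w : X) ∈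
        openSegment ℝ (AffineMap.lineMap p q u : X) (AffineMap.lineMap p q v) ↔
        w ∈ openSegment ℝ u v := by
      intro u v w
      rw [← image_openSegment, hinj.mem_set_image]
    have hp0 : (AffineMap.lineMap p q (0 : ℝ) : X) = p := AffineMap.lineMap_apply_zero p q
    have n1 := hV1 _ haV'
    have n2 := hV1 _ hbV'
    have n3 := hV2 _ haV
    have n4 := hV2 _ hbV
    have m1 : (AffineMap.lineMap p q (0 : ℝ) : X) ∈
      openSegment ℝ (AffineMap.lineMap p q s : X) (AffineMap.lineMap p q t) := by rwa [hp0]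
    have m2 : (AffineMap.lineMap p q (0 : ℝ) : X) ∈
      openSegment ℝ (AffineMap.lineMap p q s' : X) (AffineMap.lineMap p q t') := by rwa [hp0]
    rw [hmem] at n1 n2 n3 n4 m1 m2
    rcases real_openSegment_eq (fun h => hab (by rw [h])) (fun h => hab' (by rw [h]))
      m1 m2 n1 n2 n3 n4 with ⟨rfl, rfl⟩ | ⟨rfl, rfl⟩
    · exact hne rfl
    · exact hne Sym2.eq_swap
  · push Not at hq
    refine hV1 p (hV p ?_) hp
    ext z
    constructor
    · intro hz
      exact (hq z hz).symm
    · rintro rfl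
      exact ⟨hpx, hpx'⟩

/-- The mass of a sum of simple chains is at most the sum of their masses. -/
theorem mass1_sum_le {ι : Type*} [Fintype ι] (g : ι → G) (x y : ι → X) :
    mass1 (∑ i, seg (x i) (y i) (g i)) ≤ ∑ i, simpleMass (g i) (x i) (y i) := by
  classical
  let C : Set X := ⋃ i, ⋃ j, {p | segment ℝ (x i) (y i) ∩ segment ℝ (x j) (y j) = {p}}
  have hC : C.Finite := by
    refine Set.finite_iUnion fun i => Set.finite_iUnion fun j => Set.Subsingleton.finite ?_
    intro p hp q hq
    exact Set.singleton_injective (hp.symm.trans hq)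
  let V : Finset X := Finset.univ.image x ∪ Finset.univ.image y ∪ hC.toFinset
  have hxV : ∀ i, x i ∈ V := fun i => by simp [V]
  have hyV : ∀ i, y i ∈ V := fun i => by simp [V]
  have hCV : ∀ i j p, segment ℝ (x i) (y i) ∩ segment ℝ (x j) (y j) = {p} → p ∈ V := by
    intro i j p h
    refine Finset.mem_union_right _ (hC.mem_toFinset.2 ?_)
    exact Set.mem_iUnion.2 ⟨i, Set.mem_iUnion.2 ⟨j, h⟩⟩
  choose c c1 c2 c3 using fun i => subdivide V (g i) _ (x i) (y i) (hxV i) (hyV i) le_rfl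
  have hsum : ∀ s : Finset ι, chainOf (∑ i ∈ s, c i) = ∑ i ∈ s, seg (x i) (y i) (g i) ∧
      weight (∑ i ∈ s, c i) ≤ ∑ i ∈ s, simpleMass (g i) (x i) (y i) := by
    intro s
    induction s using Finset.induction_on with
    | empty => simp [chainOf, weight]
    | insert i s hi ih =>
      rw [Finset.sum_insert hi, Finset.sum_insert hi, Finset.sum_insert hi, chainOf_add, c1, ih.1]
      refine ⟨rfl, (weight_add_le _ _).trans (add_le_add ?_ ih.2)⟩
      rw [simpleMass_eq]
      exact c2 i
  obtain ⟨h1, h2⟩ := hsum Finset.univ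
  set d := ∑ i, c i with hd
  have hsupp : ∀ e ∈ d.support, ∃ i, e ∈ (c i).support := by
    intro e he
    have := Finsupp.support_finsetSum he
    simpa using this
  refine le_trans ?_ h2
  refine sInf_le ?_
  let φ := d.support.equivFin
  have o : ∀ (e : Sym2 X), s((Quot.out e).1, (Quot.out e).2) = e := fun e => Quot.out_eq e
  have key : ∀ e ∈ d.support, ∃ i, (Quot.out e).1 ≠ (Quot.out e).2 ∧ (Quot.out e).1 ∈ V ∧
      (Quot.out e).2 ∈ V ∧ (∀ v ∈ V, v ∉ openSegment ℝ (Quot.out e).1 (Quot.out e).2) ∧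
      (Quot.out e).1 ∈ segment ℝ (x i) (y i) ∧ (Quot.out e).2 ∈ segment ℝ (x i) (y i) := by
    intro e he
    obtain ⟨i, hi⟩ := hsupp e he
    obtain ⟨a, b, rfl, k2, k3, k4, k5, k6, k7⟩ := c3 i e hi
    refine ⟨i, ?_⟩
    rcases out_cases a b with ho | ho <;> rw [ho]
    · exact ⟨k2, k3, k4, k5, k6, k7⟩
    · refine ⟨k2.symm, k4, k3, ?_, k7, k6⟩
      rwa [openSegment_symm]
  refine ⟨d.support.card, fun k => d (φ.symm k), fun k => (Quot.out (φ.symm k : Sym2 X)).1,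
    fun k => (Quot.out (φ.symm k : Sym2 X)).2, ⟨?_, ?_⟩, ?_, ?_⟩
  · intro k
    obtain ⟨i, hi, -⟩ := key _ (φ.symm k).2
    exact hi
  · intro k l hkl
    obtain ⟨i, i1, i2, i3, i4, i5, i6⟩ := key _ (φ.symm k).2
    obtain ⟨j, j1, j2, j3, j4, j5, j6⟩ := key _ (φ.symm l).2
    refine disjoint_pieces (hCV i j) i1 i5 i6 i2 i3 i4 j1 j5 j6 j2 j3 j4 ?_
    rw [o, o]
    intro h
    exact hkl (φ.symm.injective (Subtype.ext h))
  · rw [← h1, chainOf, Finsupp.sum, ← Finset.sum_coe_sort d.support]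
    exact φ.symm.sum_comp fun e : d.support =>
      seg (Quot.out (e : Sym2 X)).1 (Quot.out (e : Sym2 X)).2 (d e)
  · simp only [simpleMass_eq]
    rw [weight, Finsupp.sum, ← Finset.sum_coe_sort d.support]
    exact (φ.symm.sum_comp fun e : d.support =>
      ‖d e‖ₑ * edist (Quot.out (e : Sym2 X)).1 (Quot.out (e : Sym2 X)).2).symm

theorem mass1_zero : mass1 (0 : OneChain X G) = 0 := by
  have h := mass1_sum_le (fun i : Fin 0 => (0 : G)) (fun _ => (0 : X)) (fun _ => (0 : X))
  simpa using h

theorem mass1_add_le (P Q : OneChain X G) : mass1 (P + Q) ≤ mass1 P + mass1 Q := by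
  rw [mass1.eq_def P, mass1.eq_def Q, sInf_eq_iInf', sInf_eq_iInf']
  refine ENNReal.le_iInf_add_iInf ?_
  rintro ⟨_, n, g, x, y, -, rfl, rfl⟩ ⟨_, n', g', x', y', -, rfl, rfl⟩
  have h := mass1_sum_le (Sum.elim g g') (Sum.elim x x') (Sum.elim y y')
  simpa using h

theorem mass1_neg_le (P : OneChain X G) : mass1 (-P) ≤ mass1 P := by
  refine le_sInf ?_
  rintro _ ⟨n, g, x, y, h, rfl, rfl⟩
  refine sInf_le ⟨n, fun i => -g i, x, y, h, by simp, by simp [simpleMass_eq]⟩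

end One

/-! ### The flat norm and flat `0`-chains -/

section Flat

variable {X G : Type*} [NormedAddCommGroup X] [NormedSpace ℝ X] [NormedAddCommGroup G]

/-- `inf_Q M(Q) + M(∂Q - P)` over polyhedral `1`-chains `Q`, in `[0, ∞]`. -/
def flatENorm (P : ZeroChain X G) : ℝ≥0∞ :=
  ⨅ Q : OneChain X G, mass1 Q + mass0 (boundary Q - P)

/-- The flat norm `F(P)`; the infimum is finite, see `flatENorm_ne_top`. -/
def flatNorm (P : ZeroChain X G) : ℝ := (flatENorm P).toReal

theorem flatENorm_le_mass0 (P : ZeroChain X G) : flatENorm P ≤ mass0 P := by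
  refine (iInf_le _ 0).trans ?_
  simp [mass1_zero, mass0_neg]

theorem flatENorm_ne_top (P : ZeroChain X G) : flatENorm P ≠ ∞ :=
  ne_top_of_le_ne_top (mass0_ne_top P) (flatENorm_le_mass0 P)

theorem flatENorm_add_le (P Q : ZeroChain X G) :
    flatENorm (P + Q) ≤ flatENorm P + flatENorm Q := by
  refine ENNReal.le_iInf_add_iInf ?_
  intro R S
  refine (iInf_le _ (R + S)).trans ?_
  have e : boundary (R + S) - (P + Q) = (boundary R - P) + (boundary S - Q) := by
    rw [map_add]; abel
  rw [e, add_add_add_comm]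
  exact add_le_add (mass1_add_le R S) (mass0_add_le _ _)

theorem flatENorm_neg_le (P : ZeroChain X G) : flatENorm (-P) ≤ flatENorm P := by
  refine le_iInf fun R => (iInf_le _ (-R)).trans ?_
  have e : boundary (-R) - -P = -(boundary R - P) := by rw [map_neg]; abel
  rw [e, mass0_neg]
  gcongr
  exact mass1_neg_le R

/-- Polyhedral `0`-chains carry the flat norm. -/
instance : SeminormedAddCommGroup (ZeroChain X G) :=
  AddGroupSeminorm.toSeminormedAddCommGroup
    { toFun := flatNorm
      map_zero' := by
        have h := flatENorm_le_mass0 (0 : ZeroChain X G)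
        rw [mass0_zero, nonpos_iff_eq_zero] at h
        simp [flatNorm, h]
      add_le' := fun P Q => by
        rw [flatNorm, flatNorm, flatNorm,
          ← ENNReal.toReal_add (flatENorm_ne_top P) (flatENorm_ne_top Q)]
        exact ENNReal.toReal_mono
          (ENNReal.add_ne_top.2 ⟨flatENorm_ne_top P, flatENorm_ne_top Q⟩) (flatENorm_add_le P Q)
      neg' := fun P => by
        refine congrArg ENNReal.toReal (le_antisymm (flatENorm_neg_le P) ?_)
        simpa using flatENorm_neg_le (-P) }

theorem norm_eq_flatNorm (P : ZeroChain X G) : ‖P‖ = flatNorm P := rfl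

variable (X G) in
/-- Flat `0`-chains: the completion of the polyhedral `0`-chains in the flat norm. -/
abbrev FlatZeroChain : Type _ := UniformSpace.Completion (ZeroChain X G)

/-- The mass of a flat `0`-chain `A`: the smallest `m ∈ [0, ∞]` such that some sequence of
polyhedral chains converges to `A` with masses converging to `m`. -/
def mass (A : FlatZeroChain X G) : ℝ≥0∞ :=
  sInf {m | ∃ P : ℕ → ZeroChain X G,
    Tendsto (fun i => (P i : FlatZeroChain X G)) atTop (𝓝 A) ∧
    Tendsto (fun i => mass0 (P i)) atTop (𝓝 m)}

/-- The polyhedral chains `P i` converge rapidly to `A`: `∑ F(P i - A) < ∞`. -/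
def ConvergesRapidly (P : ℕ → ZeroChain X G) (A : FlatZeroChain X G) : Prop :=
  Summable fun i => ‖(P i : FlatZeroChain X G) - A‖

/-- For a sequence `P` converging rapidly to a flat chain `A`: the value `r` is not exceptional
for `P` and `f`, and the restriction `A ⌞ f⁻¹((-∞, r)) = lim P i ⌞ f⁻¹((-∞, r))` is `B`. -/
def IsRestriction (P : ℕ → ZeroChain X G) (f : X → ℝ) (r : ℝ) (B : FlatZeroChain X G) : Prop :=
  (Summable fun i => ‖restrict0 f r (P (i + 1) - P i)‖) ∧
    Tendsto (fun i => (restrict0 f r (P i) : FlatZeroChain X G)) atTop (𝓝 B)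

/-- The support of a flat `0`-chain `A`: the points `x` for which there are non-exceptional
`r j ↓ 0` with `F(A ⌞ B(x, r j)) > 0` for all `j`. Restrictions of `A` are defined for almost
every radius only, through a rapidly converging sequence of polyhedral chains; the radii must
exist whichever sequence is used. -/
def spt (A : FlatZeroChain X G) : Set X :=
  {x | ∀ P : ℕ → ZeroChain X G, ConvergesRapidly P A →
    ∃ r : ℕ → ℝ, StrictAnti r ∧ (∀ j, 0 < r j) ∧ Tendsto r atTop (𝓝 0) ∧
      ∀ j, ∃ B : FlatZeroChain X G, IsRestriction P (fun z => dist z x) (r j) B ∧ 0 < ‖B‖}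

end Flat

end FlatChain

end

/-! The flat chains with support in `K` and mass at most `q` form a totally bounded set, and the
space of flat chains is complete. If such a chain `A` is close to a polyhedral chain `P` of mass at
most `q + 1` lying near `K`, the points of `P` can be moved into a fixed finite net of `K`. This
costs at most mass times distance. The chains on the net with coefficients in a compact ball of `G`
form a compact set (`exists_atomic_near`, `continuous_atomic`).

The difficulty is to find `P` near `K` (`exists_zeroChain_near`). Take polyhedral `P i` converging
rapidly to `A` with masses tending to that of `A`. Mass is lower semicontinuous, so a portion of `P
i` whose removal leaves a chain close to `A` must have small mass (`exists_forall_massIn_le`).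
Slicing by `1`-Lipschitz functions (`exists_majorant_restrict0`) yields two such portions: small
balls around a point off the support, and the complement of the `η`-neighbourhood of a suitable
finite set. Hence the masses vanish locally off the support and are tight. As `X` is complete,
nested intersections with shrinking balls turn this into vanishing on every closed set off the
support, in particular outside a neighbourhood of `K`. -/

namespace FlatChain

/-! ### Portions of polyhedral chains in arbitrary sets -/

section Portion

variable {X G : Type*} [NormedAddCommGroup G]

/-- The coefficients of a `0`-chain. -/
def coeff (P : ZeroChain X G) : X →₀ G := P

open Classical in
/-- The portion of the `0`-chain `P` in the set `E`. -/
noncomputable def portionIn (E : Set X) : ZeroChain X G →+ ZeroChain X G :=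
  Finsupp.filterAddHom fun x => x ∈ E

/-- The mass of the portion of the `0`-chain `P` in the set `E`. -/
noncomputable def massIn (E : Set X) (P : ZeroChain X G) : ℝ≥0∞ := mass0 (portionIn E P)

open Classical in
theorem coeff_portionIn (E : Set X) (P : ZeroChain X G) :
    coeff (portionIn E P) = (coeff P).filter (· ∈ E) := rfl

theorem mass0_eq_sum (P : ZeroChain X G) :
    mass0 P = ∑ x ∈ (coeff P).support, ‖coeff P x‖ₑ := rfl

theorem sum_pt_coeff (P : ZeroChain X G) :
    ∑ x ∈ (coeff P).support, pt x (coeff P x) = P :=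
  Finsupp.sum_single (coeff P)

theorem restrict0_eq_portionIn (f : X → ℝ) (r : ℝ) (P : ZeroChain X G) :
    restrict0 f r P = portionIn {x | f x < r} P := by
  unfold restrict0 portionIn
  congr!

theorem massIn_eq_sum (E : Set X) (P : ZeroChain X G) :
    massIn E P =
      ∑ x ∈ (coeff P).support, E.indicator (fun x => ‖(coeff P) x‖ₑ) x := by
  classical
  have h : massIn E P = ∑ x ∈ (coeff P).support, ‖((coeff P).filter (· ∈ E)) x‖ₑ :=
    Finsupp.sum_of_support_subset ((coeff P).filter (· ∈ E))
      (by rw [Finsupp.support_filter]; exact Finset.filter_subset _ _) _ (by simp)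
  rw [h]
  refine Finset.sum_congr rfl fun x _ => ?_
  by_cases hx : x ∈ E
  · rw [Set.indicator_of_mem hx, Finsupp.filter_apply_pos _ _ hx]
  · rw [Set.indicator_of_notMem hx, Finsupp.filter_apply_neg _ _ hx, enorm_zero]

theorem massIn_mono {E F : Set X} (h : E ⊆ F) (P : ZeroChain X G) :
    massIn E P ≤ massIn F P := by
  rw [massIn_eq_sum, massIn_eq_sum]
  exact Finset.sum_le_sum fun x _ => Set.indicator_le_indicator_of_subset h (by simp) x

theorem massIn_union_le (E F : Set X) (P : ZeroChain X G) :
    massIn (E ∪ F) P ≤ massIn E P + massIn F P := by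
  simp only [massIn_eq_sum, ← Finset.sum_add_distrib]
  refine Finset.sum_le_sum fun x _ => ?_
  by_cases hE : x ∈ E <;> by_cases hF : x ∈ F <;> simp [hE, hF]

theorem massIn_empty (P : ZeroChain X G) : massIn ∅ P = 0 := by
  simp [massIn_eq_sum]

theorem massIn_biUnion_le {ι : Type*} (S : Finset ι) (E : ι → Set X) (P : ZeroChain X G) :
    massIn (⋃ s ∈ S, E s) P ≤ ∑ s ∈ S, massIn (E s) P := by
  classical
  induction S using Finset.induction_on with
  | empty => simp [massIn_empty]
  | insert a S ha ih =>
    rw [Finset.set_biUnion_insert, Finset.sum_insert ha]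
    exact (massIn_union_le _ _ _).trans (by gcongr)

theorem massIn_add_compl (E : Set X) (P : ZeroChain X G) :
    massIn E P + massIn Eᶜ P = mass0 P := by
  simp only [massIn_eq_sum, mass0_eq_sum, ← Finset.sum_add_distrib]
  refine Finset.sum_congr rfl fun x _ => ?_
  by_cases hE : x ∈ E <;> simp [hE]

theorem massIn_le_mass0 (E : Set X) (P : ZeroChain X G) : massIn E P ≤ mass0 P :=
  massIn_add_compl E P ▸ le_self_add

theorem portionIn_add_compl (E : Set X) (P : ZeroChain X G) :
    portionIn E P + portionIn Eᶜ P = P := by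
  change coeff (portionIn E P) + coeff (portionIn Eᶜ P) = coeff P
  ext x
  by_cases hE : x ∈ E <;> simp [coeff_portionIn, hE]

theorem portionIn_of_support_subset {E : Set X} {P : ZeroChain X G}
    (h : ∀ x ∈ (coeff P).support, x ∈ E) : portionIn E P = P := by
  classical
  exact (Finsupp.filter_eq_self_iff (p := (· ∈ E)) (coeff P)).2 fun x hx =>
    h x (Finsupp.mem_support_iff.2 hx)

theorem mem_of_mem_support_portionIn {E : Set X} {P : ZeroChain X G} {x : X}
    (h : x ∈ (coeff (portionIn E P)).support) : x ∈ E := by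
  classical
  have h' := h
  rw [coeff_portionIn, Finsupp.support_filter, Finset.mem_filter] at h'
  exact h'.2

end Portion

/-! ### Slicing by Lipschitz functions -/

section Slicing

variable {X G : Type*} [NormedAddCommGroup X] [NormedSpace ℝ X] [NormedAddCommGroup G]

theorem enorm_eq_flatENorm (P : ZeroChain X G) : ‖P‖ₑ = flatENorm P := by
  rw [← ofReal_norm, norm_eq_flatNorm, flatNorm, ENNReal.ofReal_toReal (flatENorm_ne_top P)]

theorem flatENorm_sum_le {ι : Type*} (s : Finset ι) (P : ι → ZeroChain X G) :
    flatENorm (∑ i ∈ s, P i) ≤ ∑ i ∈ s, flatENorm (P i) := by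
  classical
  induction s using Finset.induction_on with
  | empty => simpa [mass0_zero] using flatENorm_le_mass0 (0 : ZeroChain X G)
  | insert a s ha ih =>
    rw [Finset.sum_insert ha, Finset.sum_insert ha]
    exact (flatENorm_add_le _ _).trans (by gcongr)

theorem flatENorm_dipole_le (g : G) (x y : X) : flatENorm (pt y g - pt x g) ≤ ‖g‖ₑ * edist x y := by
  refine (iInf_le _ (seg x y g)).trans ?_
  rw [boundary_seg, sub_self, mass0_zero, add_zero, ← simpleMass_eq]
  simpa using mass1_sum_le (fun _ : Unit => g) (fun _ => x) (fun _ => y)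

/-- The dipoles are the boundaries of the segments of a nearly optimal filling `Q`, and `R = P -
∂Q`. Later estimates need only this sum, not the disjointness of the segments. -/
theorem exists_dipole_decomposition {P : ZeroChain X G} {c : ℝ≥0∞} (h : flatENorm P < c) :
    ∃ (n : ℕ) (g : Fin n → G) (x y : Fin n → X) (R : ZeroChain X G),
      P = ∑ i, (pt (y i) (g i) - pt (x i) (g i)) + R ∧
      ∑ i, ‖g i‖ₑ * edist (x i) (y i) + mass0 R < c := by
  rw [flatENorm, iInf_lt_iff] at h
  obtain ⟨Q, hQ⟩ := h
  have hR := mass0_ne_top (boundary Q - P)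
  have hQ' : mass1 Q < c - mass0 (boundary Q - P) := lt_tsub_iff_right.2 hQ
  obtain ⟨_, ⟨n, g, x, y, -, hsum, rfl⟩, hm⟩ := sInf_lt_iff.1 hQ'
  refine ⟨n, g, x, y, -(boundary Q - P), ?_, ?_⟩
  · rw [← hsum, map_sum]
    simp only [boundary_seg]
    abel
  · rw [mass0_neg]
    simpa only [simpleMass_eq] using lt_tsub_iff_right.1 hm

theorem restrict0_dipole_cases (f : X → ℝ) (r : ℝ) (g : G) (x y : X) :
    restrict0 f r (pt y g - pt x g) = pt y g - pt x g ∨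
    restrict0 f r (pt y g - pt x g) = 0 ∨
    r ∈ Set.uIoc (f x) (f y) ∧ mass0 (restrict0 f r (pt y g - pt x g)) = ‖g‖ₑ := by
  rw [map_sub, restrict0_pt, restrict0_pt]
  by_cases hx : f x < r <;> by_cases hy : f y < r
  · simp [hx, hy]
  · exact Or.inr (Or.inr ⟨by simp [Set.mem_uIoc, hx, not_lt.1 hy],
      by simp [hx, hy, mass0_neg, mass0_pt]⟩)
  · exact Or.inr (Or.inr ⟨by simp [Set.mem_uIoc, hy, not_lt.1 hx],
      by simp [hx, hy, mass0_pt]⟩)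
  · simp [hx, hy]

/-- A dipole that is kept whole is filled by its segment. One that is cut leaves a single point, of
mass `|g|`, and this happens only for `r` between `f x` and `f y`. -/
theorem flatENorm_restrict0_dipole_le (f : X → ℝ) (r : ℝ) (g : G) (x y : X) :
    flatENorm (restrict0 f r (pt y g - pt x g)) ≤
      ‖g‖ₑ * edist x y + (Set.uIoc (f x) (f y)).indicator (fun _ => ‖g‖ₑ) r := by
  rcases restrict0_dipole_cases f r g x y with h | h | ⟨h1, h2⟩
  · rw [h]
    exact (flatENorm_dipole_le g x y).trans le_self_add
  · rw [h]
    exact (flatENorm_le_mass0 _).trans (mass0_zero.trans_le zero_le)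
  · rw [Set.indicator_of_mem h1]
    exact ((flatENorm_le_mass0 _).trans h2.le).trans le_add_self

/-- Slicing by a `1`-Lipschitz function: the flat norms of the portions of `P` in the sublevel sets
have a majorant whose integral is controlled by the flat norm of `P`. -/
theorem exists_majorant_restrict0 {f : X → ℝ} (hf : LipschitzWith 1 f) {P : ZeroChain X G}
    {c : ℝ≥0∞} (h : flatENorm P < c) (a : ℝ) :
    ∃ u : ℝ → ℝ≥0∞, Measurable u ∧ (∀ r, flatENorm (restrict0 f r P) ≤ u r) ∧
      ∫⁻ r in Set.Ioo 0 a, u r ≤ (1 + ENNReal.ofReal a) * c := by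
  obtain ⟨n, g, x, y, R, hP, hc⟩ := exists_dipole_decomposition h
  obtain ⟨m, hm⟩ : ∃ m, m = ∑ i, ‖g i‖ₑ * edist (x i) (y i) + mass0 R := ⟨_, rfl⟩
  rw [← hm] at hc
  -- The constant `m` pays for uncut dipoles and for `R`; the indicators pay for the cut ones.
  refine ⟨fun r => m + ∑ i, (Set.uIoc (f (x i)) (f (y i))).indicator (fun _ => ‖g i‖ₑ) r,
    ?_, ?_, ?_⟩
  · refine measurable_const.add (Finset.measurable_fun_sum _ fun i _ => ?_)
    exact measurable_const.indicator measurableSet_uIoc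
  · intro r
    have e : restrict0 f r P = ∑ i, restrict0 f r (pt (y i) (g i) - pt (x i) (g i)) +
        restrict0 f r R := by
      rw [← map_sum, ← map_add, ← hP]
    rw [e]
    refine (flatENorm_add_le _ _).trans ?_
    have h1 : flatENorm (∑ i, restrict0 f r (pt (y i) (g i) - pt (x i) (g i))) ≤
        ∑ i, (‖g i‖ₑ * edist (x i) (y i) +
          (Set.uIoc (f (x i)) (f (y i))).indicator (fun _ => ‖g i‖ₑ) r) :=
      (flatENorm_sum_le _ _).trans (Finset.sum_le_sum fun i _ => flatENorm_restrict0_dipole_le f r _ _ _)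
    have h2 : flatENorm (restrict0 f r R) ≤ mass0 R :=
      (flatENorm_le_mass0 _).trans (massIn_le_mass0 {x | f x < r} R)
    refine (add_le_add h1 h2).trans_eq ?_
    rw [Finset.sum_add_distrib, hm, add_right_comm]
  -- The constant contributes `a * m`. The indicators contribute at most `∑ |g i| |f (x i) - f (y
  -- i)|`, which is at most `m` because `f` is `1`-Lipschitz.
  · rw [lintegral_add_left measurable_const, setLIntegral_const, Real.volume_Ioo, sub_zero,
      add_mul, one_mul, add_comm, mul_comm m]
    gcongr
    rw [lintegral_finsetSum _ fun i _ => measurable_const.indicator measurableSet_uIoc]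
    refine (Finset.sum_le_sum fun i _ => ?_).trans ((le_self_add.trans hm.ge).trans hc.le)
    refine (setLIntegral_le_lintegral _ _).trans ?_
    rw [lintegral_indicator_const measurableSet_uIoc, Real.volume_uIoc, ← Real.dist_eq,
      ← edist_dist, edist_comm]
    gcongr
    simpa using hf (x i) (y i)

/-- Some radius does no worse than the mean of the majorant over `(0, a)`. -/
theorem exists_flatENorm_restrict0_le {f : X → ℝ} (hf : LipschitzWith 1 f) {P : ZeroChain X G}
    {c : ℝ≥0∞} (h : flatENorm P < c) {a : ℝ} (ha : 0 < a) :
    ∃ r ∈ Set.Ioo 0 a, flatENorm (restrict0 f r P) ≤ (1 + ENNReal.ofReal a) * c / ENNReal.ofReal a := by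
  obtain ⟨u, hu, hur, hui⟩ := exists_majorant_restrict0 hf h a
  have hv : volume (Set.Ioo 0 a) = ENNReal.ofReal a := by rw [Real.volume_Ioo, sub_zero]
  obtain ⟨r, hr, hle⟩ := exists_le_setLAverage (μ := volume) (s := Set.Ioo 0 a) (f := u)
    (by rw [hv]; simpa using ha) (by rw [hv]; simp) hu.aemeasurable
  refine ⟨r, hr, (hur r).trans (hle.trans ?_)⟩
  rw [setLAverage_eq, hv]
  gcongr

/-- Along a summable sequence of chains, the portions in almost every sublevel set are summable. -/
theorem ae_summable_norm_restrict0 {f : X → ℝ} (hf : LipschitzWith 1 f) {P : ℕ → ZeroChain X G}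
    (h : Summable fun i => ‖P i‖) (a : ℝ) :
    ∀ᵐ r ∂volume.restrict (Set.Ioo 0 a), Summable fun i => ‖restrict0 f r (P i)‖ := by
  -- The slack `(1 / 2) ^ i` provides the strict bound that the majorant requires and keeps the
  -- series summable.
  have hpos (i : ℕ) : (0 : ℝ) < (1 / 2) ^ i := by positivity
  have hlt (i : ℕ) : ‖P i‖ₑ < ENNReal.ofReal (‖P i‖ + (1 / 2) ^ i) := by
    rw [← ofReal_norm]
    exact (ENNReal.ofReal_lt_ofReal_iff (by positivity)).2 (lt_add_of_pos_right _ (hpos i))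
  choose u hu hur hui using fun i => exists_majorant_restrict0 hf (enorm_eq_flatENorm (P i) ▸ hlt i) a
  have hs : Summable fun i => ‖P i‖ + (1 / 2 : ℝ) ^ i := h.add summable_geometric_two
  -- By Tonelli the sum of the majorants has finite integral, so it is finite almost everywhere.
  have hfin : ∫⁻ r in Set.Ioo 0 a, ∑' i, u i r ≠ ∞ := by
    rw [lintegral_tsum fun i => (hu i).aemeasurable]
    refine ne_top_of_le_ne_top ?_ (ENNReal.tsum_le_tsum hui)
    rw [ENNReal.tsum_mul_left]
    exact ENNReal.mul_ne_top (by simp) hs.tsum_ofReal_ne_top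
  filter_upwards [ae_lt_top (Measurable.tsum hu) hfin] with r hr
  have h1 : ∑' i, ‖restrict0 f r (P i)‖ₑ ≠ ∞ :=
    ne_top_of_le_ne_top hr.ne (ENNReal.tsum_le_tsum fun i =>
      (enorm_eq_flatENorm _).trans_le (hur i r))
  simpa using ENNReal.summable_toReal h1

end Slicing

/-! ### Lower semicontinuity of mass and where the mass of a recovery sequence lies -/

section Mass

variable {X G : Type*} [NormedAddCommGroup X] [NormedSpace ℝ X] [NormedAddCommGroup G]

theorem coe_add (P Q : ZeroChain X G) :
    ((P + Q : ZeroChain X G) : FlatZeroChain X G) = P + Q :=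
  UniformSpace.Completion.coe_add P Q

theorem coe_sub (P Q : ZeroChain X G) :
    ((P - Q : ZeroChain X G) : FlatZeroChain X G) = P - Q :=
  UniformSpace.Completion.coe_sub P Q

theorem norm_coe (P : ZeroChain X G) : ‖(P : FlatZeroChain X G)‖ = ‖P‖ :=
  UniformSpace.Completion.norm_coe P

/-- The mass is lower semicontinuous along polyhedral chains. -/
theorem exists_forall_mass_le_mass0_add {A : FlatZeroChain X G} (hA : mass A ≠ ∞) {ε : ℝ≥0∞}
    (hε : ε ≠ 0) :
    ∃ δ > 0, ∀ P : ZeroChain X G, ‖(P : FlatZeroChain X G) - A‖ < δ → mass A ≤ mass0 P + ε := by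
  by_contra! h
  choose P hP hPm using fun n : ℕ => h (1 / ((n : ℝ) + 1)) Nat.one_div_pos_of_nat
  have hlim : Tendsto (fun n => (P n : FlatZeroChain X G)) atTop (𝓝 A) := by
    rw [tendsto_iff_norm_sub_tendsto_zero]
    exact squeeze_zero (fun _ => norm_nonneg _) (fun n => (hP n).le)
      tendsto_one_div_add_atTop_nhds_zero_nat
  -- The definition of mass asks for convergent masses; compactness of `[0, ∞]` supplies them along
  -- a subsequence.
  obtain ⟨m, φ, hφ, hm⟩ := CompactSpace.tendsto_subseq fun n => mass0 (P n)
  have h1 : mass A ≤ m := sInf_le ⟨fun n => P (φ n), hlim.comp hφ.tendsto_atTop, hm⟩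
  have h2 : m + ε ≤ mass A :=
    le_of_tendsto (hm.add_const ε) (Eventually.of_forall fun n => (hPm (φ n)).le)
  exact (ENNReal.lt_add_right hA hε).not_ge ((add_le_add_left h1 ε).trans h2)

/-- Polyhedral chains that converge rapidly to `A`, with masses that converge to that of `A`. -/
structure Recovers (P : ℕ → ZeroChain X G) (A : FlatZeroChain X G) : Prop where
  rapid : ConvergesRapidly P A
  mass_le : ∀ ε : ℝ≥0∞, ε ≠ 0 → ∀ᶠ i in atTop, mass0 (P i) ≤ mass A + ε

theorem exists_recovers {A : FlatZeroChain X G} (hA : mass A ≠ ∞) :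
    ∃ P : ℕ → ZeroChain X G, Recovers P A := by
  have h (n : ℕ) : ∃ P : ZeroChain X G, ‖(P : FlatZeroChain X G) - A‖ < (1 / 2) ^ n ∧
      mass0 P < mass A + ((n : ℝ≥0∞))⁻¹ := by
    have hlt : mass A < mass A + ((n : ℝ≥0∞))⁻¹ :=
      ENNReal.lt_add_right hA (ENNReal.inv_ne_zero.2 (ENNReal.natCast_ne_top n))
    obtain ⟨m, ⟨P, hP, hm⟩, hlt'⟩ := sInf_lt_iff.1 hlt
    have h1 := (tendsto_iff_norm_sub_tendsto_zero.1 hP).eventually_lt_const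
      (show (0 : ℝ) < (1 / 2) ^ n by positivity)
    obtain ⟨i, hi1, hi2⟩ := (h1.and (hm.eventually_lt_const hlt')).exists
    exact ⟨P i, hi1, hi2⟩
  choose P hP hPm using h
  refine ⟨P, summable_geometric_two.of_nonneg_of_le (fun _ => norm_nonneg _) fun i => (hP i).le,
    fun ε hε => ?_⟩
  filter_upwards [ENNReal.tendsto_inv_nat_nhds_zero.eventually_le_const hε.bot_lt] with n hn
  exact (hPm n).le.trans (by gcongr)

theorem ConvergesRapidly.tendsto_norm {P : ℕ → ZeroChain X G} {A : FlatZeroChain X G}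
    (h : ConvergesRapidly P A) :
    Tendsto (fun i => ‖(P i : FlatZeroChain X G) - A‖) atTop (𝓝 0) :=
  h.tendsto_atTop_zero

/-- If omitting the portion in `E` hardly changes a chain of almost minimal mass near `A`, then that
portion has small mass. -/
theorem exists_forall_massIn_le {A : FlatZeroChain X G} (hA : mass A ≠ ∞) {ε : ℝ≥0∞}
    (hε : ε ≠ 0) :
    ∃ δ > 0, ∀ (P : ZeroChain X G) (E : Set X), mass0 P ≤ mass A + ε →
      ‖(portionIn Eᶜ P : FlatZeroChain X G) - A‖ < δ → massIn E P ≤ ε + ε := by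
  obtain ⟨δ, hδ, h⟩ := exists_forall_mass_le_mass0_add hA hε
  -- The finite `mass A` is cancelled: the portion outside `E` already carries it up to `ε`, and `P`
  -- exceeds it by at most `ε`.
  refine ⟨δ, hδ, fun P E hP hPE => (ENNReal.add_le_add_iff_left hA).1 ?_⟩
  calc mass A + massIn E P ≤ (massIn Eᶜ P + ε) + massIn E P := by
        gcongr
        exact h _ hPE
    _ = mass0 P + ε := by rw [← massIn_add_compl E P]; ring
    _ ≤ mass A + ε + ε := by gcongr
    _ = mass A + (ε + ε) := add_assoc _ _ _

/-- The masses of a recovery sequence do not escape finite unions of balls. -/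
theorem Recovers.exists_finset_massIn_le {P : ℕ → ZeroChain X G} {A : FlatZeroChain X G}
    (h : Recovers P A) (hA : mass A ≠ ∞) {ε : ℝ≥0∞} (hε : ε ≠ 0) {η : ℝ} (hη : 0 < η) :
    ∃ S : Finset X, ∀ᶠ i in atTop, massIn {z | ∀ s ∈ S, η ≤ dist z s} (P i) ≤ ε + ε := by
  classical
  obtain ⟨δ, hδ, hδ'⟩ := exists_forall_massIn_le hA hε
  -- The final error is at most `t + 2 * t * (1 + η) / η`, which is below `t * D = δ / 2`.
  set D : ℝ := 1 + 2 * (1 + (1 + η) / η) with hD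
  have hD0 : 0 < D := by positivity
  set t := δ / (2 * D) with ht
  have ht0 : 0 < t := by positivity
  have htD : t * D < δ := by
    rw [ht]
    field_simp
    linarith
  have hev := h.rapid.tendsto_norm.eventually_lt_const ht0
  obtain ⟨i₀, hi₀⟩ := eventually_atTop.1 hev
  -- The extra point `0` ensures that `S` is nonempty, as the distance to `S` requires.
  set S : Finset X := insert 0 (coeff (P i₀)).support with hS
  refine ⟨S, ?_⟩
  filter_upwards [eventually_ge_atTop i₀, h.mass_le ε hε] with i hi hmi
  have hne : (S : Set X).Nonempty := ⟨0, by simp [hS]⟩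
  -- Every sublevel set of `f` at a level `r > 0` contains all of `P i₀`. Restricting `P i` to it
  -- therefore gives a chain close to `P i₀`, hence to `A`, and what lies outside has small mass.
  set f : X → ℝ := fun z => Metric.infDist z S with hf
  have hn : ‖P i - P i₀‖ < 2 * t := by
    rw [← norm_coe, coe_sub]
    calc ‖(P i : FlatZeroChain X G) - P i₀‖
        ≤ ‖(P i : FlatZeroChain X G) - A‖ + ‖(P i₀ : FlatZeroChain X G) - A‖ := by
          rw [← sub_sub_sub_cancel_right _ _ A]
          exact norm_sub_le _ _
      _ < 2 * t := by linarith [hi₀ i hi, hi₀ i₀ le_rfl]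
  have hn' : flatENorm (P i - P i₀) < ENNReal.ofReal (2 * t) := by
    rw [← enorm_eq_flatENorm, ← ofReal_norm]
    exact (ENNReal.ofReal_lt_ofReal_iff (by positivity)).2 hn
  obtain ⟨r, hr, hle⟩ := exists_flatENorm_restrict0_le
    (Metric.lipschitz_infDist_pt (S : Set X)) hn' hη
  have hle' : ‖restrict0 f r (P i - P i₀)‖ ≤ (1 + η) / η * (2 * t) := by
    refine ENNReal.toReal_le_of_le_ofReal (by positivity) (hle.trans_eq ?_)
    rw [← ENNReal.ofReal_one, ← ENNReal.ofReal_add zero_le_one hη.le,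
      ← ENNReal.ofReal_mul (by positivity), ← ENNReal.ofReal_div_of_pos hη]
    congr 1
    ring
  have hfix : restrict0 f r (P i₀) = P i₀ := by
    rw [restrict0_eq_portionIn]
    refine portionIn_of_support_subset fun x hx => ?_
    have : f x = 0 := Metric.infDist_zero_of_mem (by simp [hS, Finsupp.mem_support_iff.1 hx])
    simpa [this] using hr.1
  have hclose : ‖(restrict0 f r (P i) : FlatZeroChain X G) - A‖ < δ := by
    have e : restrict0 f r (P i) = restrict0 f r (P i - P i₀) + P i₀ := by
      rw [map_sub, hfix, sub_add_cancel]
    rw [e, coe_add, add_sub_assoc]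
    refine (norm_add_le _ _).trans_lt ?_
    rw [norm_coe]
    have h3 := hi₀ i₀ le_rfl
    have h4 : t * D = t + 2 * t + (1 + η) / η * (2 * t) := by rw [hD]; ring
    linarith
  refine (massIn_mono ?_ _).trans (hδ' (P i) {z | f z < r}ᶜ hmi ?_)
  · intro z hz hlt
    obtain ⟨s, hs, hs'⟩ := (Metric.infDist_lt_iff hne).1 (lt_trans hlt hr.2)
    exact (hz s hs).not_gt hs'
  · rwa [compl_compl, ← restrict0_eq_portionIn]

/-- By tightness, finitely many `η`-balls carry all but little of the mass; were the portions of `E`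
in all balls to vanish in the limit, so would `E`'s. -/
theorem Recovers.exists_ball_not_tendsto {P : ℕ → ZeroChain X G} {A : FlatZeroChain X G}
    (h : Recovers P A) (hA : mass A ≠ ∞) {E : Set X}
    (hE : ¬Tendsto (fun i => massIn E (P i)) atTop (𝓝 0)) {η : ℝ} (hη : 0 < η) :
    ∃ s, ¬Tendsto (fun i => massIn (E ∩ Metric.ball s η) (P i)) atTop (𝓝 0) := by
  by_contra! hs
  refine hE (ENNReal.tendsto_nhds_zero.2 fun ε hε => ?_)
  have hε3 : ε / 3 ≠ 0 := ENNReal.div_ne_zero.2 ⟨hε.ne', by simp⟩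
  obtain ⟨S, hS⟩ := h.exists_finset_massIn_le hA hε3 hη
  have hsum : Tendsto (fun i => ∑ s ∈ S, massIn (E ∩ Metric.ball s η) (P i)) atTop (𝓝 0) := by
    simpa using tendsto_finsetSum S fun s _ => hs s
  filter_upwards [hS, ENNReal.tendsto_nhds_zero.1 hsum _ hε3.bot_lt] with i hi1 hi2
  have hsub : E ⊆ {z | ∀ s ∈ S, η ≤ dist z s} ∪ ⋃ s ∈ S, E ∩ Metric.ball s η := by
    intro z hz
    by_cases hz' : ∀ s ∈ S, η ≤ dist z s
    · exact Or.inl hz'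
    · push Not at hz'
      obtain ⟨s, hs1, hs2⟩ := hz'
      exact Or.inr (Set.mem_biUnion hs1 ⟨hz, hs2⟩)
  calc massIn E (P i) ≤ _ := massIn_mono hsub _
    _ ≤ _ := massIn_union_le _ _ _
    _ ≤ (ε / 3 + ε / 3) + ε / 3 := add_le_add hi1 ((massIn_biUnion_le _ _ _).trans hi2)
    _ = ε := ENNReal.add_thirds ε

theorem ConvergesRapidly.summable_sub {P Q : ℕ → ZeroChain X G} {A : FlatZeroChain X G}
    (hP : ConvergesRapidly P A) (hQ : ConvergesRapidly Q A) :
    Summable fun i => ‖P i - Q i‖ := by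
  refine (Summable.add hP hQ).of_nonneg_of_le (fun _ => norm_nonneg _) fun i => ?_
  rw [← norm_coe, coe_sub, ← sub_sub_sub_cancel_right _ _ A]
  exact norm_sub_le _ _

/-- Near a point off the support of `A`, the masses of a recovery sequence vanish in the limit. -/
theorem Recovers.exists_ball_tendsto {P : ℕ → ZeroChain X G} {A : FlatZeroChain X G}
    (h : Recovers P A) (hA : mass A ≠ ∞) {x : X} (hx : x ∉ spt A) :
    ∃ r > 0, Tendsto (fun i => massIn (Metric.ball x r) (P i)) atTop (𝓝 0) := by
  rw [spt, Set.mem_ofPred_eq] at hx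
  push Not at hx
  obtain ⟨Q, hQ, hx⟩ := hx
  set f : X → ℝ := fun z => dist z x with hf
  have hfl : LipschitzWith 1 f := LipschitzWith.dist_left x
  -- Otherwise non-exceptional radii with nonzero restriction accumulate at `0`, and a strictly
  -- decreasing sequence of them contradicts the choice of `Q`.
  obtain ⟨a, ha, hvanish⟩ : ∃ a > 0, ∀ r ∈ Set.Ioo 0 a, ∀ B : FlatZeroChain X G,
      IsRestriction Q f r B → B = 0 := by
    by_contra! hc
    let T : Set ℝ := {r | 0 < r ∧ ∃ B : FlatZeroChain X G, IsRestriction Q f r B ∧ 0 < ‖B‖}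
    have hT : ∀ a > 0, ∃ r ∈ T, r < a := fun a ha => by
      obtain ⟨r, hr, B, hB, hB0⟩ := hc a ha
      exact ⟨r, ⟨hr.1, B, hB, norm_pos_iff.2 hB0⟩, hr.2⟩
    have hglb : IsGLB T 0 := by
      refine ⟨fun r hr => hr.1.le, fun b hb => not_lt.1 fun hb0 => ?_⟩
      obtain ⟨r, hr, hrb⟩ := hT b hb0
      exact (hb hr).not_gt hrb
    obtain ⟨r₀, hr₀, -⟩ := hT 1 one_pos
    obtain ⟨u, hu1, hu2, hu3, hu4⟩ := hglb.exists_seq_strictAnti_tendsto_of_notMem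
      (fun h0 => h0.1.false) ⟨r₀, hr₀⟩
    obtain ⟨j, hj⟩ := hx u hu1 hu2 hu3
    obtain ⟨B, hB, hB0⟩ := (hu4 j).2
    exact (hj B hB).not_gt hB0
  have hQs : Summable fun i => ‖Q (i + 1) - Q i‖ :=
    ConvergesRapidly.summable_sub (P := fun i => Q (i + 1)) ((summable_nat_add_iff 1).2 hQ) hQ
  have h1 := ae_summable_norm_restrict0 hfl hQs a
  have h2 := ae_summable_norm_restrict0 hfl (h.rapid.summable_sub hQ) a
  have hmem : ∀ᵐ r ∂volume.restrict (Set.Ioo 0 a), r ∈ Set.Ioo 0 a :=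
    ae_restrict_mem measurableSet_Ioo
  have hne : (volume.restrict (Set.Ioo 0 a)) ≠ 0 := by
    rw [Ne, Measure.restrict_eq_zero, Real.volume_Ioo]
    simpa using ha
  have : (ae (volume.restrict (Set.Ioo 0 a))).NeBot := ae_neBot.2 hne
  -- At this radius the restriction along `Q` exists, so it is zero, and the restrictions of `P i -
  -- Q i` tend to zero; thus those of `P i` tend to zero too.
  obtain ⟨r, ⟨hr1, hr2⟩, hr⟩ := ((h1.and h2).and hmem).exists
  have hcau : CauchySeq fun i => (restrict0 f r (Q i) : FlatZeroChain X G) := by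
    refine cauchySeq_of_summable_dist ?_
    refine hr1.congr fun i => ?_
    rw [dist_comm, dist_eq_norm, ← coe_sub, norm_coe, map_sub]
  obtain ⟨B, hB⟩ := cauchySeq_tendsto_of_complete hcau
  obtain rfl := hvanish r hr B ⟨hr1, hB⟩
  have hPr : Tendsto (fun i => (restrict0 f r (P i) : FlatZeroChain X G)) atTop (𝓝 0) := by
    have h3 : Tendsto (fun i => ((restrict0 f r (P i - Q i) : ZeroChain X G) :
        FlatZeroChain X G)) atTop (𝓝 0) := by
      rw [tendsto_zero_iff_norm_tendsto_zero]
      simpa only [norm_coe] using hr2.tendsto_atTop_zero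
    have h4 := h3.add hB
    rw [add_zero] at h4
    refine h4.congr fun i => ?_
    rw [← coe_add, map_sub, sub_add_cancel]
  refine ⟨r, hr.1, ENNReal.tendsto_nhds_zero.2 fun ε hε => ?_⟩
  have hε2 : ε / 2 ≠ 0 := (ENNReal.half_pos hε.ne').ne'
  obtain ⟨δ, hδ, hδ'⟩ := exists_forall_massIn_le hA hε2
  have hlim : Tendsto (fun i => ‖(P i : FlatZeroChain X G) - A‖ +
      ‖(restrict0 f r (P i) : FlatZeroChain X G)‖) atTop (𝓝 0) := by
    simpa using h.rapid.tendsto_norm.add hPr.norm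
  filter_upwards [hlim.eventually_lt_const hδ, h.mass_le _ hε2] with i hi hmi
  have hball : Metric.ball x r = {z | f z < r} := rfl
  rw [← ENNReal.add_halves ε]
  refine hδ' (P i) _ hmi (lt_of_le_of_lt ?_ hi)
  have e := portionIn_add_compl (Metric.ball x r) (P i)
  rw [hball, ← restrict0_eq_portionIn] at e
  have e' : (portionIn {z | f z < r}ᶜ (P i) : FlatZeroChain X G) - A =
      ((P i : FlatZeroChain X G) - A) - (restrict0 f r (P i) : FlatZeroChain X G) := by
    nth_rw 2 [← e]
    rw [coe_add]
    abel
  rw [hball, e']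
  exact norm_sub_le _ _

/-- The masses of a recovery sequence vanish in the limit on closed sets off the support. -/
theorem Recovers.tendsto_massIn_of_isClosed [CompleteSpace X] {P : ℕ → ZeroChain X G}
    {A : FlatZeroChain X G} (h : Recovers P A) (hA : mass A ≠ ∞) {Z : Set X} (hZ : IsClosed Z)
    (hZA : Disjoint Z (spt A)) : Tendsto (fun i => massIn Z (P i)) atTop (𝓝 0) := by
  by_contra hcon
  let T := {E : Set X // ¬Tendsto (fun i => massIn E (P i)) atTop (𝓝 0)}
  choose s hs using fun (E : T) (n : ℕ) =>
    h.exists_ball_not_tendsto hA E.2 (η := (1 / 2) ^ n) (by positivity)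
  -- Nested subsets of `Z` in ever smaller balls, none of whose masses tends to `0`.
  let E : ℕ → T := Nat.rec ⟨Z, hcon⟩ fun n F => ⟨F.1 ∩ Metric.ball (s F n) ((1 / 2) ^ n), hs F n⟩
  have hsucc (n : ℕ) : (E (n + 1)).1 = (E n).1 ∩ Metric.ball (s (E n) n) ((1 / 2) ^ n) := rfl
  have hanti : Antitone fun n => (E n).1 :=
    antitone_nat_of_succ_le fun n => (hsucc n).trans_subset Set.inter_subset_left
  have hnonempty (n : ℕ) : (E n).1.Nonempty := by
    rw [Set.nonempty_iff_ne_empty]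
    intro he
    refine (E n).2 ?_
    simp [he, massIn_empty]
  have hdist (n : ℕ) {y z : X} (hy : y ∈ (E (n + 1)).1) (hz : z ∈ (E (n + 1)).1) :
      dist y z ≤ 2 * (1 / 2) ^ n := by
    have hy' : dist y (s (E n) n) < (1 / 2) ^ n := (hsucc n ▸ hy).2
    have hz' : dist z (s (E n) n) < (1 / 2) ^ n := (hsucc n ▸ hz).2
    linarith [dist_triangle_right y z (s (E n) n)]
  -- The index is shifted because `E 0` is `Z`, whose diameter is not controlled.
  choose x hx using fun n => hnonempty (n + 1)
  have hxc : CauchySeq x := cauchySeq_of_le_geometric (1 / 2) 2 (by norm_num) fun n =>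
    hdist n (hx n) (hanti (Nat.le_succ (n + 1)) (hx (n + 1)))
  obtain ⟨y, hy⟩ := cauchySeq_tendsto_of_complete hxc
  have hyZ : y ∈ Z :=
    hZ.mem_of_tendsto hy (Eventually.of_forall fun n => hanti (Nat.zero_le (n + 1)) (hx n))
  obtain ⟨r, hr, hlim⟩ := h.exists_ball_tendsto hA (Set.disjoint_left.1 hZA hyZ)
  have hg : Tendsto (fun n : ℕ => 2 * (1 / 2 : ℝ) ^ n + dist (x n) y) atTop (𝓝 0) := by
    have h1 : Tendsto (fun n : ℕ => (1 / 2 : ℝ) ^ n) atTop (𝓝 0) :=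
      tendsto_pow_atTop_nhds_zero_of_lt_one (by norm_num) (by norm_num)
    simpa using (h1.const_mul 2).add (tendsto_iff_dist_tendsto_zero.1 hy)
  -- For such `n` the whole of `E (n + 1)` lies in the ball around `y`, where the mass vanishes in
  -- the limit.
  obtain ⟨n, hn⟩ := (hg.eventually_lt_const hr).exists
  refine (E (n + 1)).2 (tendsto_of_tendsto_of_tendsto_of_le_of_le tendsto_const_nhds hlim
    (fun _ => zero_le) fun i => massIn_mono (fun z hz => ?_) _)
  rw [Metric.mem_ball]
  linarith [dist_triangle z (x n) y, hdist n hz (hx n)]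

end Mass

/-! ### Approximation by chains on a finite net, and total boundedness -/

section Compactness

variable {X G : Type*} [NormedAddCommGroup X] [NormedSpace ℝ X] [NormedAddCommGroup G]

/-- A flat chain of finite mass is a limit of polyhedral chains of almost minimal mass near its
support. -/
theorem exists_zeroChain_near [CompleteSpace X] {A : FlatZeroChain X G} (hA : mass A ≠ ∞)
    {K : Set X} (hK : spt A ⊆ K) {η ε : ℝ} (hη : 0 < η) (hε : 0 < ε) :
    ∃ P : ZeroChain X G, (∀ x ∈ (coeff P).support, x ∈ Metric.thickening η K) ∧
      mass0 P ≤ mass A + 1 ∧ ‖(P : FlatZeroChain X G) - A‖ < ε := by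
  obtain ⟨P, hP⟩ := exists_recovers hA
  set U := Metric.thickening η K with hU
  have hlim : Tendsto (fun i => massIn Uᶜ (P i)) atTop (𝓝 0) :=
    hP.tendsto_massIn_of_isClosed hA Metric.isOpen_thickening.isClosed_compl
      (disjoint_compl_left.mono_right (hK.trans (Metric.self_subset_thickening hη K)))
  have hε2 : 0 < ε / 2 := half_pos hε
  obtain ⟨i, ⟨hi1, hi2⟩, hi3⟩ := (((hP.mass_le 1 one_ne_zero).and
    (hP.rapid.tendsto_norm.eventually_lt_const hε2)).and
    (hlim.eventually_lt_const (ENNReal.ofReal_pos.2 hε2))).exists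
  -- The discarded portion has small mass, hence small flat norm.
  refine ⟨portionIn U (P i), fun x => mem_of_mem_support_portionIn,
    (massIn_le_mass0 _ _).trans hi1, ?_⟩
  have hsmall : ‖portionIn Uᶜ (P i)‖ < ε / 2 :=
    ENNReal.toReal_lt_of_lt_ofReal ((flatENorm_le_mass0 _).trans_lt hi3)
  have e : (portionIn U (P i) : FlatZeroChain X G) - A =
      ((P i : FlatZeroChain X G) - A) - (portionIn Uᶜ (P i) : FlatZeroChain X G) := by
    nth_rw 2 [← portionIn_add_compl U (P i)]
    rw [coe_add]
    abel
  rw [e]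
  refine (norm_sub_le _ _).trans_lt ?_
  rw [norm_coe]
  linarith

/-- The flat chain with coefficient `c t` at each point `t` of the finite set `T`. -/
noncomputable def atomic (T : Finset X) (c : X → G) : FlatZeroChain X G :=
  ((∑ t ∈ T, pt t (c t) : ZeroChain X G) : FlatZeroChain X G)

/-- For each `t` the map `g ↦ g [t]` is `1`-Lipschitz, since the flat norm is at most the mass; only
finitely many coordinates of `c` matter. -/
theorem continuous_atomic (T : Finset X) : Continuous (atomic T : (X → G) → _) := by
  have hpt (t : X) : Continuous fun g : G => (pt t g : ZeroChain X G) := by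
    refine LipschitzWith.continuous (K := 1) (LipschitzWith.of_dist_le_mul fun g h => ?_)
    rw [dist_eq_norm, dist_eq_norm, NNReal.coe_one, one_mul]
    have e : (pt t g - pt t h : ZeroChain X G) = pt t (g - h) := (map_sub _ _ _).symm
    refine (congrArg norm e).trans_le ?_
    refine ENNReal.toReal_le_of_le_ofReal (norm_nonneg _) ((flatENorm_le_mass0 _).trans ?_)
    rw [mass0_pt, ofReal_norm]
  refine (UniformSpace.Completion.continuous_coe _).comp ?_
  exact continuous_finsetSum T fun t _ => (hpt t).comp (continuous_apply t)

/-- Moving the points of a chain into the finite set `T`. -/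
theorem exists_atomic_near {P : ZeroChain X G} {T : Finset X} {η : ℝ} {m : ℝ≥0}
    (hm : mass0 P ≤ m) (hT : ∀ x ∈ (coeff P).support, ∃ t ∈ T, dist x t < η) (hη : 0 ≤ η) :
    ∃ c : X → G, (∀ t, ‖c t‖ ≤ m) ∧ ‖(P : FlatZeroChain X G) - atomic T c‖ ≤ m * η := by
  classical
  choose! π hπ hπη using hT
  -- The coefficients of all points moved to `t` are added; the triangle inequality bounds the sum
  -- by the mass of `P`.
  refine ⟨fun t => ∑ x ∈ (coeff P).support with π x = t, coeff P x, fun t => ?_, ?_⟩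
  · refine ENNReal.toReal_le_of_le_ofReal (a := ‖_‖ₑ) m.2 ?_ |>.trans' (toReal_enorm _).ge
    refine (enorm_sum_le _ _).trans ?_
    refine (Finset.sum_le_sum_of_subset (Finset.filter_subset _ _)).trans ?_
    rw [← mass0_eq_sum]
    exact hm.trans_eq (ENNReal.ofReal_coe_nnreal).symm
  · have e : P - ∑ t ∈ T, pt t (∑ x ∈ (coeff P).support with π x = t, coeff P x) =
        ∑ x ∈ (coeff P).support, (pt x (coeff P x) - pt (π x) (coeff P x)) := by
      rw [Finset.sum_sub_distrib, sum_pt_coeff, ← Finset.sum_fiberwise_of_maps_to hπ]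
      congr 1
      refine Finset.sum_congr rfl fun t _ => ?_
      rw [map_sum]
      refine Finset.sum_congr rfl fun x hx => ?_
      rw [(Finset.mem_filter.1 hx).2]
    rw [atomic, ← coe_sub, norm_coe, e]
    refine ENNReal.toReal_le_of_le_ofReal (by positivity) ((flatENorm_sum_le _ _).trans ?_)
    calc ∑ x ∈ (coeff P).support, flatENorm (pt x (coeff P x) - pt (π x) (coeff P x))
        ≤ ∑ x ∈ (coeff P).support, ‖coeff P x‖ₑ * ENNReal.ofReal η := by
          refine Finset.sum_le_sum fun x hx => (flatENorm_dipole_le _ _ _).trans ?_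
          gcongr
          rw [edist_comm, edist_dist]
          exact ENNReal.ofReal_le_ofReal (hπη x hx).le
      _ = mass0 P * ENNReal.ofReal η := by rw [← Finset.sum_mul, mass0_eq_sum]
      _ ≤ ENNReal.ofReal (m * η) := by
          rw [ENNReal.ofReal_mul m.coe_nonneg, ENNReal.ofReal_coe_nnreal]
          gcongr

/-- Flat chains with bounded masses and with supports in a compact set are totally bounded. -/
theorem totallyBounded_flatZeroChain [CompleteSpace X]
    (hG : ∀ d : ℝ, IsCompact {g : G | ‖g‖ ≤ d}) {K : Set X} (hK : IsCompact K) (q : ℝ≥0) :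
    TotallyBounded {A : FlatZeroChain X G | spt A ⊆ K ∧ mass A ≤ q} := by
  rw [Metric.totallyBounded_iff]
  intro ε hε
  set m : ℝ≥0 := q + 1 with hm
  have hm0 : (0 : ℝ) < m := by positivity
  -- Points within `η` of `K` are within `2 * η` of the net, so moving mass `m` there costs `m * (2
  -- * η) = ε / 4`.
  set η : ℝ := ε / 4 / (2 * m) with hη
  have hη0 : 0 < η := by positivity
  obtain ⟨T, hTfin, hTK⟩ := Metric.totallyBounded_iff.1 hK.totallyBounded η hη0
  -- Tychonoff: the coefficients range over a product of compact balls, chosen independently of `A`.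
  have hC : IsCompact (atomic hTfin.toFinset '' Set.univ.pi fun _ : X => {g : G | ‖g‖ ≤ m}) :=
    (isCompact_univ_pi fun _ => hG m).image (continuous_atomic _)
  obtain ⟨N, hNfin, hN⟩ := Metric.totallyBounded_iff.1 hC.totallyBounded (ε / 2) (half_pos hε)
  refine ⟨N, hNfin, ?_⟩
  rintro A ⟨hAK, hAq⟩
  obtain ⟨P, hPK, hPm, hPA⟩ := exists_zeroChain_near
    (ne_top_of_le_ne_top ENNReal.coe_ne_top hAq) hAK hη0 (show 0 < ε / 4 by positivity)
  have hPm' : mass0 P ≤ m := by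
    refine hPm.trans ?_
    rw [hm, ENNReal.coe_add, ENNReal.coe_one]
    gcongr
  have hPT : ∀ x ∈ (coeff P).support, ∃ t ∈ hTfin.toFinset, dist x t < 2 * η := by
    intro x hx
    obtain ⟨y, hy, hxy⟩ := Metric.mem_thickening_iff.1 (hPK x hx)
    obtain ⟨t, ht, hyt⟩ := Set.mem_iUnion₂.1 (hTK hy)
    refine ⟨t, hTfin.mem_toFinset.2 ht, ?_⟩
    rw [Metric.mem_ball] at hyt
    linarith [dist_triangle x y t]
  obtain ⟨c, hc, hPc⟩ := exists_atomic_near hPm' hPT (by positivity)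
  obtain ⟨n, hn, hcn⟩ := Set.mem_iUnion₂.1 (hN ⟨c, fun t _ => hc t, rfl⟩)
  refine Set.mem_iUnion₂.2 ⟨n, hn, ?_⟩
  rw [Metric.mem_ball] at hcn ⊢
  have h1 : (m : ℝ) * (2 * η) = ε / 4 := by
    rw [hη]
    field_simp
  rw [h1, ← dist_eq_norm] at hPc
  rw [← dist_eq_norm] at hPA
  -- The errors are `ε / 4` for approximation by `P`, `ε / 4` for moving points and `ε / 2` for the
  -- finite net `N`.
  linarith [dist_triangle A (atomic hTfin.toFinset c) n,
    dist_triangle_left A (atomic hTfin.toFinset c) (P : FlatZeroChain X G)]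

end Compactness

end FlatChain

theorem mainTheorem7 {X G : Type*} [NormedAddCommGroup X] [NormedSpace ℝ X] [CompleteSpace X]
    [NormedAddCommGroup G] [CompleteSpace G]
    (A : ℕ → FlatChain.FlatZeroChain X G)
    (hG : ∀ d : ℝ, IsCompact {g : G | ‖g‖ ≤ d})
    (K : Set X) (hK : IsCompact K) (hA : ∀ j, FlatChain.spt (A j) ⊆ K)
    (q : ℝ≥0) (hq : ∀ j, FlatChain.mass (A j) ≤ q) :
    ∃ (φ : ℕ → ℕ) (B : FlatChain.FlatZeroChain X G),
      StrictMono φ ∧ Tendsto (fun j => A (φ j)) atTop (𝓝 B) := by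
  have hc := TotallyBounded.isCompact_of_isClosed
    (FlatChain.totallyBounded_flatZeroChain (G := G) hG hK q).closure isClosed_closure
  obtain ⟨B, -, φ, hφ, hB⟩ := hc.tendsto_subseq fun j => subset_closure ⟨hA j, hq j⟩
  exact ⟨φ, B, hφ, hB⟩
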